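/- A convex polygon in $\mathbb{R}^3$ is the convex hull of finitely many points that is two-dimensional; its sides are its one-dimensional faces. A side-contact representation of a graph $G$ is a family $(P_v)_{v\in V(G)}$ of convex polygons in $\mathbb{R}^3$ with pairwise disjoint relative interiors, such that no segment is a side of more than two of the polygons, and such that two distinct vertices $v,w$ are adjacent in $G$ if and only if $P_v$ and $P_w$ have a full side in common. **Theorem.** The complete bipartite graph $K_{3,250}$ has no side-contact representation by convex polygons in $\mathbb{R}^3$. -/

import Mathlib

/-- A convex polygon in a real vector space: the convex hull of finitely many points
whose affine span has dimension two. -/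
def IsConvexPolygon {E : Type*} [AddCommGroup E] [Module ℝ E] (p : Set E) : Prop :=
  (∃ c : Finset E, p = convexHull ℝ (c : Set E)) ∧ Module.finrank ℝ (vectorSpan ℝ p) = 2

/-- `s` is a side of the convex polygon `p`: a face of `p` (the set of maximizers on `p` of a
linear functional) of dimension one. -/
def IsPolygonSide {E : Type*} [AddCommGroup E] [Module ℝ E] [TopologicalSpace E]
    (p s : Set E) : Prop :=
  IsExposed ℝ p s ∧ Module.finrank ℝ (vectorSpan ℝ s) = 1

/-- The family `p` of sets in 3-space is a side-contact representation of the graph `G`: the sets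
are convex polygons, their (relative) interiors are pairwise disjoint, no segment is a side of
more than two of them, and two distinct vertices are adjacent if and only if their polygons have
a full side in common. -/
structure IsSideContactRepresentation {V : Type*} (G : SimpleGraph V)
    (p : V → Set (EuclideanSpace ℝ (Fin 3))) : Prop where
  isConvexPolygon : ∀ v, IsConvexPolygon (p v)
  interior_disjoint : ∀ v w, v ≠ w →
    Disjoint (intrinsicInterior ℝ (p v)) (intrinsicInterior ℝ (p w))
  side_le_two : ∀ s, {v | IsPolygonSide (p v) s}.encard ≤ 2
  adj_iff : ∀ v w, v ≠ w →
    (G.Adj v w ↔ ∃ s, IsPolygonSide (p v) s ∧ IsPolygonSide (p w) s)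

/-- `G` has a side-contact representation by convex polygons in 3-space. -/
def HasSideContactRepresentation {V : Type*} (G : SimpleGraph V) : Prop :=
  ∃ p : V → Set (EuclideanSpace ℝ (Fin 3)), IsSideContactRepresentation G p

/-!
# `K_{3,250}` has no side-contact representation

Let `A 0, A 1, A 2` and `B j` be the polygons of such a representation, and `s i j` the common side
of `A i` and `B j`. A side supports its polygon within the plane of the polygon, so the plane of
`B j`, which contains the side `s i j` of `A i`, has `A i` on one of its sides, and the plane of
`A k` has `B j` on one of its sides (`IsPolygonSide.nonneg_or_nonpos`).

If no two of the `A i` are coplanar, let `h i = 0` be the plane of `A i`. Leaving out at most nine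
`B j` with a side on a line in which two of the planes meet, choose an inner point `x i j` of each
`s i j`; then the sign of `h k (x i j)` for `i ≠ k` depends on `j` and `k` only. Let `j` and `j'`,
possibly equal, agree in these signs. If `∑ k, a k • h k` has, for each `i`, opposite weak signs at
`x i j` and `x i j'`, then all `a k` vanish, because otherwise any two of the `a k`, multiplied by
the signs of the `h k`, would have opposite strict signs (`IsSideGrid.coeff_eq_zero`). This
shows in turn that the `h i` are linearly independent, that no remaining plane of a `B j` passes
through the (possibly infinite) common point of the three planes, and that, when the equations of
the planes of the `B j` are normalized at that point, two of them with the same signs on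
the `A i` and the same signs of the `h k` agree. There are only `8 * 8` sign patterns, so
at most `73` polygons `B j` are possible (`IsSideGrid.exists_coplanar`).

If two of the `A i` are coplanar, then all the polygons are, and they would give a plane drawing of
`K_{3,3}`. Choose distinct inner points `x i j` of the sides. For `i ≠ i'` the triangles
`x i 0, x i 1, x i 2` and `x i' 0, x i' 1, x i' 2` are joined by three disjoint segments inside
`B 0, B 1, B 2`; the order in which these cross a line separating `A i` from `A i'` determines the
orientations of both triangles, which are therefore opposite (`det_mul_det_neg`). Three
triangles cannot have pairwise opposite orientations (`IsSideGrid.false_of_coplanar`).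
-/

/-! ### Polygons and their sides -/

section Polygons

variable {E : Type*} [NormedAddCommGroup E] [NormedSpace ℝ E]

theorem AffineMap.apply_add_smul_add_smul (f : E →ᵃ[ℝ] ℝ) (a b c : E) (α β : ℝ) :
    f (a + α • (b - a) + β • (c - a)) = f a + α * (f b - f a) + β * (f c - f a) := by
  have h (x v : E) : f (x + v) = f x + f.linear v := by
    simpa [add_comm] using f.map_vadd x v
  have h' (x y : E) : f.linear (x - y) = f x - f y := by
    simpa using f.linearMap_vsub x y
  simp [h, h']

theorem exists_ne_of_finrank_vectorSpan {s : Set E}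
    (hs : Module.finrank ℝ (vectorSpan ℝ s) = 1) : ∃ a ∈ s, ∃ b ∈ s, a ≠ b := by
  by_contra! h
  have : s.Subsingleton := fun a ha b hb => h a ha b hb
  rw [(vectorSpan_eq_bot_iff_subsingleton ℝ).2 this] at hs
  simp at hs

theorem IsConvexPolygon.convex {P : Set E} (hP : IsConvexPolygon P) : Convex ℝ P := by
  obtain ⟨⟨c, rfl⟩, -⟩ := hP
  exact convex_convexHull ℝ _

theorem IsConvexPolygon.exists_eq_add_smul {P : Set E} (hP : IsConvexPolygon P) {a b c : E}
    (ha : a ∈ P) (hb : b ∈ P) (hc : c ∈ P) (h : LinearIndependent ℝ ![b - a, c - a])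
    {p : E} (hp : p ∈ P) : ∃ α β : ℝ, p = a + α • (b - a) + β • (c - a) := by
  have hfin : FiniteDimensional ℝ (vectorSpan ℝ P) :=
    Module.finite_of_finrank_pos (by rw [hP.2]; norm_num)
  have hle : Submodule.span ℝ (Set.range ![b - a, c - a]) ≤ vectorSpan ℝ P := by
    rw [Submodule.span_le]
    rintro _ ⟨i, rfl⟩
    fin_cases i
    · exact vsub_mem_vectorSpan ℝ hb ha
    · exact vsub_mem_vectorSpan ℝ hc ha
  have heq := Submodule.eq_of_le_of_finrank_eq hle (by rw [finrank_span_eq_card h, hP.2]; rfl)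
  have hmem : p - a ∈ Submodule.span ℝ (Set.range ![b - a, c - a]) := by
    rw [heq]; exact vsub_mem_vectorSpan ℝ hp ha
  simp only [Matrix.range_cons, Matrix.range_empty, Set.union_empty, Set.singleton_union,
    Submodule.mem_span_pair] at hmem
  obtain ⟨α, β, h⟩ := hmem
  exact ⟨α, β, by rw [add_assoc, h]; abel⟩

theorem IsPolygonSide.subset {P s : Set E} (hs : IsPolygonSide P s) : s ⊆ P := hs.1.subset

theorem IsPolygonSide.convex {P s : Set E} (hP : IsConvexPolygon P) (hs : IsPolygonSide P s) :
    Convex ℝ s := hs.1.convex hP.convex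

theorem IsPolygonSide.exists_affineMap {P s : Set E} (hs : IsPolygonSide P s) :
    ∃ g : E →ᵃ[ℝ] ℝ, (∀ x ∈ P, 0 ≤ g x) ∧ ∀ x, x ∈ s ↔ x ∈ P ∧ g x = 0 := by
  obtain ⟨x₀, h₀, -⟩ := exists_ne_of_finrank_vectorSpan hs.2
  obtain ⟨l, rfl⟩ := hs.1 ⟨x₀, h₀⟩
  refine ⟨AffineMap.const ℝ E (l x₀) - (l : E →ₗ[ℝ] ℝ).toAffineMap, fun x hx => ?_, fun x => ?_⟩
  · simpa using h₀.2 x hx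
  · simp only [Set.mem_ofPred_eq, AffineMap.coe_sub, AffineMap.coe_const, LinearMap.coe_toAffineMap,
      Pi.sub_apply, Function.const_apply, ContinuousLinearMap.coe_coe]
    constructor
    · rintro ⟨hx, h⟩
      exact ⟨hx, by linarith [h x₀ h₀.1, h₀.2 x hx]⟩
    · rintro ⟨hx, h⟩
      exact ⟨hx, fun y hy => by linarith [h₀.2 y hy]⟩

theorem IsPolygonSide.ne {P s : Set E} (hP : IsConvexPolygon P) (hs : IsPolygonSide P s) :
    s ≠ P := by
  rintro rfl
  have h1 := hs.2
  have h2 := hP.2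
  omega

/-- An affine functional that vanishes on a side is, on the polygon, a multiple of any functional
exposing that side, because the side and one more point span the plane of the polygon. -/
theorem IsPolygonSide.eq_mul_of_forall_eq_zero {P s : Set E} (hP : IsConvexPolygon P)
    (hs : IsPolygonSide P s) {g : E →ᵃ[ℝ] ℝ} (hg : ∀ x, x ∈ s ↔ x ∈ P ∧ g x = 0)
    {f : E →ᵃ[ℝ] ℝ} (hf : ∀ x ∈ s, f x = 0) : ∃ r : ℝ, ∀ x ∈ P, f x = r * g x := by
  obtain ⟨a, ha, b, hb, hab⟩ := exists_ne_of_finrank_vectorSpan hs.2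
  obtain ⟨c, hc, hcs⟩ : ∃ c ∈ P, c ∉ s := by
    by_contra! h
    exact hs.ne hP (hs.subset.antisymm h)
  have hgc : g c ≠ 0 := fun h => hcs ((hg c).2 ⟨hc, h⟩)
  have hga := ((hg a).1 ha).2
  have hgb := ((hg b).1 hb).2
  have hlin (x y : E) : g.linear (x - y) = g x - g y := by simpa using g.linearMap_vsub x y
  have hind : LinearIndependent ℝ ![b - a, c - a] := by
    rw [LinearIndependent.pair_iff]
    intro α β h
    have h1 := congrArg g.linear h
    simp only [map_add, map_smul, hlin, hga, hgb, map_zero, smul_eq_mul] at h1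
    have hβ : β = 0 := by
      have : β * g c = 0 := by linarith
      exact (mul_eq_zero.1 this).resolve_right hgc
    subst hβ
    simp only [zero_smul, add_zero, smul_eq_zero, sub_eq_zero] at h
    exact ⟨h.resolve_right (Ne.symm hab), rfl⟩
  refine ⟨f c / g c, fun x hx => ?_⟩
  obtain ⟨α, β, rfl⟩ := hP.exists_eq_add_smul (hs.subset ha) (hs.subset hb) hc hind hx
  rw [AffineMap.apply_add_smul_add_smul, AffineMap.apply_add_smul_add_smul, hf a ha, hf b hb,
    hga, hgb]
  field_simp
  ring

/-- A line that contains a side of a polygon supports the polygon: an affine functional vanishing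
on a side has constant sign. -/
theorem IsPolygonSide.nonneg_or_nonpos {P s : Set E} (hP : IsConvexPolygon P)
    (hs : IsPolygonSide P s) {f : E →ᵃ[ℝ] ℝ} (hf : ∀ x ∈ s, f x = 0) :
    (∀ x ∈ P, 0 ≤ f x) ∨ ∀ x ∈ P, f x ≤ 0 := by
  obtain ⟨g, hg0, hg⟩ := hs.exists_affineMap
  obtain ⟨r, hr⟩ := hs.eq_mul_of_forall_eq_zero hP hg hf
  rcases le_total 0 r with h | h
  · exact Or.inl fun x hx => hr x hx ▸ mul_nonneg h (hg0 x hx)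
  · exact Or.inr fun x hx => hr x hx ▸ mul_nonpos_of_nonpos_of_nonneg h (hg0 x hx)

theorem IsPolygonSide.eq_zero_or_mem {P s : Set E} (hP : IsConvexPolygon P)
    (hs : IsPolygonSide P s) {f : E →ᵃ[ℝ] ℝ} (hf : ∀ x ∈ s, f x = 0) :
    (∀ x ∈ P, f x = 0) ∨ ∀ x ∈ P, f x = 0 → x ∈ s := by
  obtain ⟨g, hg0, hg⟩ := hs.exists_affineMap
  obtain ⟨r, hr⟩ := hs.eq_mul_of_forall_eq_zero hP hg hf
  by_cases h : r = 0
  · exact Or.inl fun x hx => by rw [hr x hx, h, zero_mul]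
  · exact Or.inr fun x hx h0 => (hg x).2
      ⟨hx, (mul_eq_zero.1 ((hr x hx).symm.trans h0)).resolve_left h⟩

/-- Two distinct sides of a polygon span its plane. -/
theorem IsPolygonSide.eq_zero_of_ne {P s t : Set E} (hP : IsConvexPolygon P)
    (hs : IsPolygonSide P s) (ht : IsPolygonSide P t) (hst : s ≠ t) {f : E →ᵃ[ℝ] ℝ}
    (hfs : ∀ x ∈ s, f x = 0) (hft : ∀ x ∈ t, f x = 0) : ∀ x ∈ P, f x = 0 := by
  rcases hs.eq_zero_or_mem hP hfs with h | h
  · exact h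
  rcases ht.eq_zero_or_mem hP hft with h' | h'
  · exact h'
  exact absurd (Set.Subset.antisymm (fun x hx => h' x (hs.subset hx) (hfs x hx))
    fun x hx => h x (ht.subset hx) (hft x hx)) hst

/-- `x` lies strictly between two distinct points of `s`; for a side `s` this describes the
relative interior of `s`. -/
def IsInnerPoint (s : Set E) (x : E) : Prop :=
  ∃ a ∈ s, ∃ b ∈ s, a ≠ b ∧ x ∈ openSegment ℝ a b

theorem IsInnerPoint.mem {P s : Set E} {x : E} (hx : IsInnerPoint s x) (hP : IsConvexPolygon P)
    (hs : IsPolygonSide P s) : x ∈ s := by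
  obtain ⟨a, ha, b, hb, -, h⟩ := hx
  exact (hs.convex hP).openSegment_subset ha hb h

theorem IsPolygonSide.infinite_isInnerPoint {P s : Set E} (hs : IsPolygonSide P s) :
    {x | IsInnerPoint s x}.Infinite := by
  obtain ⟨a, ha, b, hb, hab⟩ := exists_ne_of_finrank_vectorSpan hs.2
  refine Set.Infinite.mono (s := openSegment ℝ a b) (fun x hx => ⟨a, ha, b, hb, hab, hx⟩) ?_
  rw [openSegment_eq_image_lineMap]
  exact (Set.Ioo_infinite zero_lt_one).image (AffineMap.lineMap_injective ℝ hab).injOn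

/-- A supporting functional of the polygon that attains its extreme value `0` at an inner point of
a side vanishes on the whole side. -/
theorem IsPolygonSide.eq_zero_of_isInnerPoint {P s : Set E}
    (hs : IsPolygonSide P s) {x : E} (hx : IsInnerPoint s x) {f : E →ᵃ[ℝ] ℝ}
    (hf : (∀ y ∈ P, 0 ≤ f y) ∨ ∀ y ∈ P, f y ≤ 0) (hfx : f x = 0) : ∀ y ∈ s, f y = 0 := by
  obtain ⟨a, ha, b, hb, hab, α, β, hα, hβ, hαβ, rfl⟩ := hx
  have hlin (x y : E) : f.linear (x - y) = f x - f y := by simpa using f.linearMap_vsub x y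
  have hfx' : α * f a + β * f b = 0 := by
    rw [← hfx, Convex.combo_affine_apply hαβ]; simp
  have hab0 : f a = 0 ∧ f b = 0 := by
    rcases hf with hf | hf
    · have h1 := hf a (hs.subset ha)
      have h2 := hf b (hs.subset hb)
      constructor <;> nlinarith [mul_nonneg hα.le h1, mul_nonneg hβ.le h2]
    · have h1 := hf a (hs.subset ha)
      have h2 := hf b (hs.subset hb)
      constructor <;> nlinarith [mul_nonneg hα.le (neg_nonneg.2 h1),
        mul_nonneg hβ.le (neg_nonneg.2 h2)]
  intro y hy
  obtain ⟨r, hr⟩ := exists_smul_eq_of_finrank_eq_one hs.2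
    (x := ⟨b - a, vsub_mem_vectorSpan ℝ hb ha⟩)
    (by simpa [sub_eq_zero] using hab.symm) ⟨y - a, vsub_mem_vectorSpan ℝ hy ha⟩
  have h := congrArg f.linear (congrArg Subtype.val hr)
  simp only [SetLike.mk_smul_mk, map_smul, hlin, hab0.1, hab0.2] at h
  simpa using h.symm

end Polygons

/-! ### Polygons that are pairwise not coplanar -/

section SpatialCase

theorem eq_zero_or_mul_neg {b c x y x' y' : ℝ} (hx : 0 < x) (hy : 0 < y) (hx' : 0 < x')
    (hy' : 0 < y') (h : (b * x + c * y ≤ 0 ∧ 0 ≤ b * x' + c * y') ∨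
      (0 ≤ b * x + c * y ∧ b * x' + c * y' ≤ 0)) : (b = 0 ∧ c = 0) ∨ b * c < 0 := by
  have key (b c : ℝ) (h : b * x + c * y ≤ 0 ∧ 0 ≤ b * x' + c * y') :
      (b = 0 ∧ c = 0) ∨ b * c < 0 := by
    obtain ⟨h1, h2⟩ := h
    rcases lt_trichotomy b 0 with hb | hb | hb
    · have : 0 < c := by
        by_contra! hc
        nlinarith [mul_pos (neg_pos.2 hb) hx', mul_nonneg (neg_nonneg.2 hc) hy'.le]
      exact Or.inr (mul_neg_of_neg_of_pos hb this)
    · subst hb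
      have h3 : c ≤ 0 := by
        by_contra! hc
        nlinarith [mul_pos hc hy]
      have h4 : 0 ≤ c := by
        by_contra! hc
        nlinarith [mul_pos (neg_pos.2 hc) hy']
      exact Or.inl ⟨rfl, le_antisymm h3 h4⟩
    · have : c < 0 := by
        by_contra! hc
        nlinarith [mul_pos hb hx, mul_nonneg hc hy.le]
      exact Or.inr (mul_neg_of_pos_of_neg hb this)
  rcases h with h | h
  · exact key b c h
  · simpa using key (-b) (-c) ⟨by linarith, by linarith⟩

/-- Three coefficients vanish if, for each `i`, the combination of the other two with positive
weights takes both weak signs: any two coefficients are zero or of opposite strict signs, and three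
reals cannot have pairwise opposite signs. The weights `u i k` and `u' i k` are positive only after
multiplication by a sign `σ k`. -/
theorem coeff_eq_zero {a σ : Fin 3 → ℝ} {u u' : Fin 3 → Fin 3 → ℝ} (hσ : ∀ k, σ k * σ k = 1)
    (hu : ∀ i k, i ≠ k → 0 < σ k * u i k ∧ 0 < σ k * u' i k)
    (hd : ∀ i, u i i = 0 ∧ u' i i = 0)
    (h : ∀ i, (∑ k, a k * u i k ≤ 0 ∧ 0 ≤ ∑ k, a k * u' i k) ∨
      (0 ≤ ∑ k, a k * u i k ∧ ∑ k, a k * u' i k ≤ 0)) : a = 0 := by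
  have hm (k : Fin 3) (t : ℝ) : a k * t = (σ k * a k) * (σ k * t) := by
    linear_combination (-(a k * t)) * hσ k
  have h0 := h 0
  have h1 := h 1
  have h2 := h 2
  simp only [Fin.sum_univ_three, (hd _).1, (hd _).2, mul_zero, zero_add, add_zero] at h0 h1 h2
  simp only [hm] at h0 h1 h2
  have e0 := eq_zero_or_mul_neg (hu 0 1 (by decide)).1 (hu 0 2 (by decide)).1
    (hu 0 1 (by decide)).2 (hu 0 2 (by decide)).2 h0
  have e1 := eq_zero_or_mul_neg (hu 1 0 (by decide)).1 (hu 1 2 (by decide)).1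
    (hu 1 0 (by decide)).2 (hu 1 2 (by decide)).2 h1
  have e2 := eq_zero_or_mul_neg (hu 2 0 (by decide)).1 (hu 2 1 (by decide)).1
    (hu 2 0 (by decide)).2 (hu 2 1 (by decide)).2 h2
  have hz : σ 0 * a 0 = 0 ∧ σ 1 * a 1 = 0 ∧ σ 2 * a 2 = 0 := by
    rcases e0 with ⟨p, q⟩ | e0
    · rcases e1 with ⟨r, -⟩ | e1
      · exact ⟨r, p, q⟩
      · simp [q] at e1
    · rcases e1 with ⟨p, q⟩ | e1
      · simp [q] at e0
      · rcases e2 with ⟨p, q⟩ | e2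
        · simp [p] at e1
        · nlinarith [mul_pos_of_neg_of_neg e0 e1, sq_nonneg (σ 2 * a 2)]
  have hs (k : Fin 3) (hk : σ k * a k = 0) : a k = 0 := by
    have := hσ k
    rcases mul_eq_zero.1 hk with h | h
    · simp [h] at this
    · exact h
  funext k
  fin_cases k
  · exact hs 0 hz.1
  · exact hs 1 hz.2.1
  · exact hs 2 hz.2.2

variable {E : Type*} [NormedAddCommGroup E] [NormedSpace ℝ E]

/-- In 3-space the affine functionals vanishing on a polygon form a line, spanned by an equation of
its plane. -/
theorem IsConvexPolygon.exists_planeEquation (hE : Module.finrank ℝ E = 3) {P : Set E}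
    (hP : IsConvexPolygon P) : ∃ h : E →ᵃ[ℝ] ℝ, h ≠ 0 ∧ (∀ x ∈ P, h x = 0) ∧
      ∀ f : E →ᵃ[ℝ] ℝ, (∀ x ∈ P, f x = 0) → ∃ r : ℝ, f = r • h := by
  have hfin : FiniteDimensional ℝ E := Module.finite_of_finrank_pos (by omega)
  obtain ⟨a, ha⟩ : P.Nonempty := by
    rw [Set.nonempty_iff_ne_empty]
    rintro rfl
    have := hP.2
    rw [vectorSpan_empty, finrank_bot] at this
    omega
  have hU := Subspace.finrank_add_finrank_dualAnnihilator_eq (vectorSpan ℝ P)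
  rw [hP.2, hE] at hU
  obtain ⟨D, hD⟩ : ∃ D : Submodule ℝ (E →ₗ[ℝ] ℝ), D = (vectorSpan ℝ P).dualAnnihilator :=
    ⟨_, rfl⟩
  have hD1 : Module.finrank ℝ D = 1 := by
    subst hD
    exact Nat.add_left_cancel (n := 2) hU
  obtain ⟨l, hl, hl0'⟩ := D.exists_mem_ne_zero_of_ne_bot (by rintro rfl; simp at hD1)
  have hlspan := exists_smul_eq_of_finrank_eq_one hD1 (x := (⟨l, hl⟩ : D))
    (by simpa [Subtype.ext_iff] using hl0')
  rw [hD, Submodule.mem_dualAnnihilator] at hl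
  refine ⟨l.toAffineMap - AffineMap.const ℝ E (l a), ?_, ?_, ?_⟩
  · intro h
    apply hl0'
    have := congrArg AffineMap.linear h
    simpa using this
  · intro x hx
    have := hl _ (vsub_mem_vectorSpan ℝ hx ha)
    simpa [sub_eq_zero] using this
  · intro f hf
    have hlin (x y : E) : f.linear (x - y) = f x - f y := by simpa using f.linearMap_vsub x y
    obtain ⟨r, hr⟩ := hlspan ⟨f.linear, by
      rw [hD, Submodule.mem_dualAnnihilator]
      intro w hw
      have hle : vectorSpan ℝ P ≤ LinearMap.ker f.linear := by
        rw [vectorSpan_def, Submodule.span_le]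
        rintro _ ⟨x, hx, y, hy, rfl⟩
        simp [hlin, hf x hx, hf y hy]
      exact hle hw⟩
    refine ⟨r, AffineMap.ext fun x => ?_⟩
    have h1 := LinearMap.congr_fun (congrArg Subtype.val hr) (x - a)
    simp only [SetLike.mk_smul_mk, LinearMap.smul_apply, hlin, hf a ha, sub_zero, map_sub] at h1
    have h2 : f x = r * (l x - l a) := by linear_combination -h1
    simpa using h2

theorem finrank_affineMap_real (hE : Module.finrank ℝ E = 3) :
    Module.finrank ℝ (E →ᵃ[ℝ] ℝ) = 4 := by
  have hfin : FiniteDimensional ℝ E := Module.finite_of_finrank_pos (by omega)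
  have h1 : Module.finrank ℝ (E →ₗ[ℝ] ℝ) = 3 := by rw [← hE]; exact Subspace.dual_finrank_eq
  rw [LinearEquiv.finrank_eq (AffineMap.toConstProdLinearMap (k := ℝ) (V1 := E) (V2 := ℝ) ℝ),
    Module.finrank_prod, h1]
  simp

/-- Two families of polygons `A i` and `B j` such that `A i` and `B j` have the side `s i j` in
common, different pairs having different common sides. -/
structure IsSideGrid {I J : Type*} (A : I → Set E) (B : J → Set E) (s : I → J → Set E) :
    Prop where
  left : ∀ i, IsConvexPolygon (A i)
  right : ∀ j, IsConvexPolygon (B j)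
  side_left : ∀ i j, IsPolygonSide (A i) (s i j)
  side_right : ∀ i j, IsPolygonSide (B j) (s i j)
  inj_left : ∀ i j i' j', s i j = s i' j' → i = i'
  inj_right : ∀ i j i' j', s i j = s i' j' → j = j'

variable {J : Type*} {A : Fin 3 → Set E} {B : J → Set E} {s : Fin 3 → J → Set E}
  {x : Fin 3 → J → E} {h : Fin 3 → E →ᵃ[ℝ] ℝ}

namespace IsSideGrid

theorem eq_zero_on_side (G : IsSideGrid A B s) (hx : ∀ i j, IsInnerPoint (s i j) (x i j))
    (hA : ∀ i, ∀ p ∈ A i, h i p = 0) {i k : Fin 3} {j : J} (h0 : h k (x i j) = 0) :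
    ∀ p ∈ s i j, h k p = 0 :=
  (G.side_right i j).eq_zero_of_isInnerPoint (hx i j)
    ((G.side_right k j).nonneg_or_nonpos (G.right j)
      fun p hp => hA k p ((G.side_left k j).subset hp)) h0

/-- If the polygons `A i` and `A k` are not coplanar, then the line in which their planes meet
contains at most one side of `A i`, so at most one index is exceptional for each pair. -/
theorem exceptional_unique (G : IsSideGrid A B s) (hx : ∀ i j, IsInnerPoint (s i j) (x i j))
    (hA : ∀ i, ∀ p ∈ A i, h i p = 0) {i k : Fin 3} (hik : ¬ ∀ p ∈ A i, h k p = 0) {j j' : J}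
    (h0 : h k (x i j) = 0) (h0' : h k (x i j') = 0) : j = j' := by
  by_contra hne
  exact hik ((G.side_left i j).eq_zero_of_ne (G.left i) (G.side_left i j')
    (fun e => hne (G.inj_right _ _ _ _ e)) (G.eq_zero_on_side hx hA h0)
    (G.eq_zero_on_side hx hA h0'))

/-- At an unexceptional index `j`, the points `x i j` with `i ≠ k` lie strictly on one side of the
plane of `A k`, because `B j` has the side `s k j` in that plane. -/
theorem forall_pos_or_forall_neg (G : IsSideGrid A B s)
    (hx : ∀ i j, IsInnerPoint (s i j) (x i j)) (hA : ∀ i, ∀ p ∈ A i, h i p = 0) {j : J}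
    (hj : ∀ i k, i ≠ k → h k (x i j) ≠ 0) (k : Fin 3) :
    (∀ i, i ≠ k → 0 < h k (x i j)) ∨ ∀ i, i ≠ k → h k (x i j) < 0 := by
  have hmem (i) : x i j ∈ B j := (G.side_right i j).subset ((hx i j).mem (G.right j)
    (G.side_right i j))
  rcases (G.side_right k j).nonneg_or_nonpos (G.right j)
    (fun p hp => hA k p ((G.side_left k j).subset hp)) with hs | hs
  · exact Or.inl fun i hi => lt_of_le_of_ne (hs _ (hmem i)) (hj i k hi).symm
  · exact Or.inr fun i hi => lt_of_le_of_ne (hs _ (hmem i)) (hj i k hi)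

/-- Two indices of the same sign pattern with respect to the planes of the `A k` admit no
nontrivial combination of the plane equations that takes opposite weak signs at them. -/
theorem coeff_eq_zero (G : IsSideGrid A B s)
    (hx : ∀ i j, IsInnerPoint (s i j) (x i j)) (hA : ∀ i, ∀ p ∈ A i, h i p = 0) {j j' : J}
    (hj : ∀ i k, i ≠ k → h k (x i j) ≠ 0) (hj' : ∀ i k, i ≠ k → h k (x i j') ≠ 0)
    (hjj' : ∀ k, (∀ i, i ≠ k → 0 < h k (x i j)) ↔ ∀ i, i ≠ k → 0 < h k (x i j'))
    {a : Fin 3 → ℝ}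
    (ha : ∀ i, ((∑ k, a k • h k) (x i j) ≤ 0 ∧ 0 ≤ (∑ k, a k • h k) (x i j')) ∨
      (0 ≤ (∑ k, a k • h k) (x i j) ∧ (∑ k, a k • h k) (x i j') ≤ 0)) : a = 0 := by
  classical
  refine _root_.coeff_eq_zero (u := fun i k => h k (x i j)) (u' := fun i k => h k (x i j'))
    (σ := fun k => if ∀ i, i ≠ k → 0 < h k (x i j) then 1 else -1) ?_ ?_ ?_ ?_
  · intro k; split_ifs <;> norm_num
  · intro i k hik
    split_ifs with hp
    · rw [one_mul, one_mul]
      exact ⟨hp i hik, (hjj' k).1 hp i hik⟩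
    · have h1 := (G.forall_pos_or_forall_neg hx hA hj k).resolve_left hp i hik
      have h2 := (G.forall_pos_or_forall_neg hx hA hj' k).resolve_left
        (fun hp' => hp ((hjj' k).2 hp')) i hik
      exact ⟨by linarith, by linarith⟩
  · exact fun i => ⟨hA i _ ((G.side_left i j).subset ((hx i j).mem (G.left i) (G.side_left i j))),
      hA i _ ((G.side_left i j').subset ((hx i j').mem (G.left i) (G.side_left i j')))⟩
  · simpa [Fin.sum_univ_three] using ha

/-- If there are more than `73 = 9 + 8 * 8` polygons `B j`, then two of the `A i` are coplanar:
apart from at most nine exceptional indices, the normalized plane equation of `B j` is determined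
by the sides of the planes of the `A i` on which `B j` lies and the sides of the plane of `B j` on
which the `A i` lie. -/
theorem exists_coplanar [Fintype J] (hE : Module.finrank ℝ E = 3) (G : IsSideGrid A B s)
    (hJ : 73 < Fintype.card J) : ∃ i k, i ≠ k ∧ ∃ h : E →ᵃ[ℝ] ℝ, h ≠ 0 ∧ (∀ p ∈ A i, h p = 0) ∧
      ∀ p ∈ A k, h p = 0 := by
  classical
  by_contra! hcon
  choose h hh0 hA hspan using fun i => (G.left i).exists_planeEquation hE
  choose f hf0 hB _ using fun j => (G.right j).exists_planeEquation hE
  choose x hx using fun i j => (G.side_left i j).infinite_isInnerPoint.nonempty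
  have hxA (i j) : x i j ∈ A i :=
    (G.side_left i j).subset ((hx i j).mem (G.left i) (G.side_left i j))
  have hxB (i j) : x i j ∈ B j :=
    (G.side_right i j).subset ((hx i j).mem (G.right j) (G.side_right i j))
  have hncop (i k) (hik : i ≠ k) : ¬ ∀ p ∈ A i, h k p = 0 := fun h' => by
    obtain ⟨p, hp, hp0⟩ := hcon i k hik (h k) (hh0 k) h'
    exact hp0 (hA k p hp)
  -- the exceptional indices
  let X : Finset J := Finset.univ.biUnion fun ik : Fin 3 × Fin 3 =>
    if ik.1 ≠ ik.2 then Finset.univ.filter (fun j => h ik.2 (x ik.1 j) = 0) else ∅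
  have hX : X.card ≤ 9 := by
    refine (Finset.card_biUnion_le_card_mul _ _ 1 fun ik _ => ?_).trans (by simp)
    split_ifs with hik
    · refine Finset.card_le_one.2 fun j hj j' hj' => ?_
      exact G.exceptional_unique hx hA (hncop _ _ hik) (Finset.mem_filter.1 hj).2
        (Finset.mem_filter.1 hj').2
    · simp
  have hR (j) (hj : j ∈ Xᶜ) : ∀ i k, i ≠ k → h k (x i j) ≠ 0 := by
    intro i k hik h0
    refine Finset.mem_compl.1 hj (Finset.mem_biUnion.2 ⟨(i, k), Finset.mem_univ _, ?_⟩)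
    rw [if_pos hik]
    exact Finset.mem_filter.2 ⟨Finset.mem_univ _, h0⟩
  have hRcard : 64 < Xᶜ.card := by
    rw [Finset.card_compl]
    omega
  -- the plane equations `h i` are independent
  have hind : LinearIndependent ℝ h := by
    obtain ⟨j, hj⟩ := Finset.card_pos.1 (by omega : 0 < Xᶜ.card)
    refine Fintype.linearIndependent_iff.2 fun a ha i => ?_
    exact congrFun (G.coeff_eq_zero hx hA (hR j hj) (hR j hj) (fun _ => Iff.rfl) (a := a)
      (by intro i; rw [ha]; simp)) i
  have hW := finrank_affineMap_real hE
  have hWfin : FiniteDimensional ℝ (E →ᵃ[ℝ] ℝ) := Module.finite_of_finrank_pos (by omega)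
  set S : Submodule ℝ (E →ᵃ[ℝ] ℝ) := Submodule.span ℝ (Set.range h) with hS
  have hS3 : Module.finrank ℝ S = 3 := by
    rw [hS, finrank_span_eq_card hind, Fintype.card_fin]
  have hQ : Module.finrank ℝ ((E →ᵃ[ℝ] ℝ) ⧸ S) = Module.finrank ℝ ℝ := by
    have := S.finrank_quotient_add_finrank
    rw [Module.finrank_self]
    omega
  -- `ω` is evaluation at the (possibly infinite) common point of the planes `h i = 0`
  obtain ⟨ω, hω⟩ : ∃ ω : (E →ᵃ[ℝ] ℝ) →ₗ[ℝ] ℝ, ∀ g, ω g = 0 → ∃ a : Fin 3 → ℝ,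
      ∑ k, a k • h k = g := by
    refine ⟨(LinearEquiv.ofFinrankEq _ _ hQ).toLinearMap ∘ₗ S.mkQ, fun g hg => ?_⟩
    rw [LinearMap.comp_apply, LinearEquiv.coe_coe, LinearEquiv.map_eq_zero_iff,
      Submodule.mkQ_apply, Submodule.Quotient.mk_eq_zero] at hg
    exact (Submodule.mem_span_range_iff_exists_fun ℝ).1 hg
  have hωf (j) (hj : j ∈ Xᶜ) : ω (f j) ≠ 0 := by
    intro h0
    obtain ⟨a, ha⟩ := hω _ h0
    have := G.coeff_eq_zero hx hA (hR j hj) (hR j hj) (fun _ => Iff.rfl) (a := a)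
      (by intro i; rw [ha, hB j _ (hxB i j)]; simp)
    apply hf0 j
    rw [← ha, this]
    simp
  let φ : J → E →ᵃ[ℝ] ℝ := fun j => (ω (f j))⁻¹ • f j
  have hφω (j) (hj : j ∈ Xᶜ) : ω (φ j) = 1 := by
    simp only [φ, map_smul, smul_eq_mul]
    exact inv_mul_cancel₀ (hωf j hj)
  have hφB (j) : ∀ p ∈ B j, φ j p = 0 := fun p hp => by simp [φ, hB j p hp]
  have hφA (j) (i) : (∀ p ∈ A i, 0 ≤ φ j p) ∨ ∀ p ∈ A i, φ j p ≤ 0 :=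
    (G.side_left i j).nonneg_or_nonpos (G.left i)
      fun p hp => hφB j p ((G.side_right i j).subset hp)
  obtain ⟨j, hj, j', hj', hne, heq⟩ := Finset.exists_ne_map_eq_of_card_lt_of_maps_to
    (s := Xᶜ) (t := (Finset.univ : Finset ((Fin 3 → Bool) × (Fin 3 → Bool))))
    (f := fun j => (fun k => decide (∀ i, i ≠ k → 0 < h k (x i j)),
      fun i => decide (∀ p ∈ A i, 0 ≤ φ j p)))
    (by simpa using hRcard) (fun _ _ => Finset.mem_coe.2 (Finset.mem_univ _))
  simp only [Prod.mk.injEq, funext_iff, decide_eq_decide] at heq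
  obtain ⟨a, ha⟩ := hω (φ j - φ j') (by rw [map_sub, hφω j hj, hφω j' hj', sub_self])
  have ha0 := G.coeff_eq_zero hx hA (hR j hj) (hR j' hj') heq.1 (a := a) (by
    intro i
    rw [ha]
    simp only [AffineMap.coe_sub, Pi.sub_apply, hφB j _ (hxB i j), hφB j' _ (hxB i j'), zero_sub,
      sub_zero]
    by_cases hp : ∀ p ∈ A i, 0 ≤ φ j p
    · exact Or.inl ⟨neg_nonpos.2 ((heq.2 i).1 hp _ (hxA i j)), hp _ (hxA i j')⟩
    · exact Or.inr ⟨neg_nonneg.2 (((hφA j' i).resolve_left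
        fun hp' => hp ((heq.2 i).2 hp')) _ (hxA i j)), (hφA j i).resolve_left hp _ (hxA i j')⟩)
  have hφ : φ j = φ j' := by
    rw [← sub_eq_zero, ← ha, ha0]
    simp
  -- `B j` and `B j'` lie in one plane, which contains two sides of `A 0`
  have hA0 : ∀ p ∈ A 0, φ j p = 0 :=
    (G.side_left 0 j).eq_zero_of_ne (G.left 0) (G.side_left 0 j')
      (fun e => hne (G.inj_right _ _ _ _ e))
      (fun p hp => hφB j p ((G.side_right 0 j).subset hp))
      (fun p hp => hφ ▸ hφB j' p ((G.side_right 0 j').subset hp))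
  obtain ⟨r, hr⟩ := hspan 0 _ hA0
  have h1 : r * h 0 (x 1 j) = 0 := by
    have := hφB j _ (hxB 1 j)
    rw [hr] at this
    simpa using this
  rcases mul_eq_zero.1 h1 with h1 | h1
  · have := hφω j hj
    rw [hr, h1, zero_smul, map_zero] at this
    exact zero_ne_one this
  · exact hR j hj 1 0 (by decide) h1

end IsSideGrid

end SpatialCase

/-! ### Orientations of triangles joined by disjoint segments -/

section PlaneOrientation

/-- The determinant of two vectors of `ℝ × ℝ`. -/
def planeDet (u v : ℝ × ℝ) : ℝ := u.1 * v.2 - u.2 * v.1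

theorem linearMap_apply_prod (f : ℝ × ℝ →ₗ[ℝ] ℝ) (v : ℝ × ℝ) :
    f v = v.1 * f (1, 0) + v.2 * f (0, 1) := by
  conv_lhs => rw [show v = v.1 • ((1, 0) : ℝ × ℝ) + v.2 • ((0, 1) : ℝ × ℝ) by ext <;> simp]
  rw [map_add, map_smul, map_smul, smul_eq_mul, smul_eq_mul]

/-- The linear dependence of three vectors of the plane, under a functional. -/
theorem apply_mul_planeDet (f : ℝ × ℝ →ₗ[ℝ] ℝ) (u v w : ℝ × ℝ) :
    f w * planeDet u v = f u * planeDet w v - f v * planeDet w u := by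
  rw [linearMap_apply_prod f u, linearMap_apply_prod f v, linearMap_apply_prod f w]
  simp only [planeDet]
  ring

/-- Three points each of which is cut off from the other two by a line through it are not
collinear. -/
theorem det_ne_zero_of_separated {p₀ p₁ p₂ : ℝ × ℝ} {f₀ f₁ f₂ : ℝ × ℝ →ₗ[ℝ] ℝ}
    (h01 : f₀ (p₁ - p₀) < 0) (h02 : f₀ (p₂ - p₀) < 0)
    (h10 : f₁ (p₀ - p₁) < 0) (h12 : f₁ (p₂ - p₁) < 0)
    (h20 : f₂ (p₀ - p₂) < 0) (h21 : f₂ (p₁ - p₂) < 0) : planeDet (p₁ - p₀) (p₂ - p₀) ≠ 0 := by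
  intro hD
  set u := p₁ - p₀ with hu
  set v := p₂ - p₀ with hv
  have e1 : p₀ - p₁ = -u := by simp [hu]
  have e2 : p₂ - p₁ = v - u := by simp [hu, hv]
  have e3 : p₀ - p₂ = -v := by simp [hv]
  have e4 : p₁ - p₂ = u - v := by simp [hu, hv]
  rw [e1, map_neg] at h10
  rw [e2, map_sub] at h12
  rw [e3, map_neg] at h20
  rw [e4, map_sub] at h21
  -- `u` and `v` are positive multiples of each other
  have key (f : ℝ × ℝ →ₗ[ℝ] ℝ) : f₀ v * f u = f₀ u * f v := by
    rw [linearMap_apply_prod f u, linearMap_apply_prod f v, linearMap_apply_prod f₀ u,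
      linearMap_apply_prod f₀ v]
    simp only [planeDet] at hD
    linear_combination (f₀ (0, 1) * f (1, 0) - f₀ (1, 0) * f (0, 1)) * hD
  have k1 := key f₁
  have k2 := key f₂
  have a1 : f₀ u < f₀ v := by
    by_contra! hc
    nlinarith [mul_pos (neg_pos.2 h01) (show 0 < f₁ u - f₁ v by linarith),
      mul_nonneg (sub_nonneg.2 hc) (show 0 ≤ f₁ u by linarith)]
  nlinarith [mul_pos (neg_pos.2 h02) (show 0 < f₂ v - f₂ u by linarith),
    mul_pos (sub_pos.2 a1) (show 0 < f₂ v by linarith)]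

/-- The inner product with `e`: the coordinate in the direction `e`, up to the factor `|e|`. -/
def along (e : ℝ × ℝ) (v : ℝ × ℝ) : ℝ := e.1 * v.1 + e.2 * v.2

/-- The coordinate orthogonal to `e`, up to the factor `|e|`. -/
def height (e : ℝ × ℝ) (v : ℝ × ℝ) : ℝ := e.1 * v.2 - e.2 * v.1

theorem along_neg (e v : ℝ × ℝ) : along (-e) v = -along e v := by simp [along]; ring

theorem height_neg (e v : ℝ × ℝ) : height (-e) v = -height e v := by simp [height]; ring

/-- Let two disjoint segments `[p, q]` and `[p', q']` meet the line `along e = c` at `m` and `m'`.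
If `p` is at least as far from the line as `p'`, then `p'` is on the same side of the first segment
as `m'`. -/
theorem det_mul_height_pos {e p q m p' q' m' : ℝ × ℝ} {c : ℝ}
    (hpq : along e p < along e q) (hm : m ∈ segment ℝ p q)
    (hm' : m' ∈ segment ℝ p' q') (hmc : along e m = c) (hmc' : along e m' = c)
    (hpp' : along e p ≤ along e p') (hp' : along e p' ≤ c)
    (hdisj : Disjoint (segment ℝ p q) (segment ℝ p' q')) :
    0 < planeDet (q - p) (p' - p) * (height e m' - height e m) := by
  obtain ⟨l, hl, rfl⟩ : ∃ l ∈ Set.Icc (0 : ℝ) 1, p + l • (q - p) = m := by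
    rwa [segment_eq_image', Set.mem_image] at hm
  -- the point of the first segment above or below `p'`
  have hX : 0 < along e q - along e p := by linarith
  set t : ℝ := (along e p' - along e p) / (along e q - along e p) with ht
  have htX : t * (along e q - along e p) = along e p' - along e p := by
    rw [ht]; field_simp
  have hlX : l * (along e q - along e p) = c - along e p := by
    rw [← hmc]; simp [along]; ring
  have ht0 : 0 ≤ t := by rw [ht]; exact div_nonneg (by linarith) hX.le
  have htl : t ≤ l := by
    by_contra! hc
    nlinarith [mul_pos (sub_pos.2 hc) hX]
  -- height difference at `p'`, and at the line
  set α : ℝ := height e p' - height e (p + t • (q - p)) with hα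
  set β : ℝ := height e m' - height e (p + l • (q - p)) with hβ
  have hne : ∀ r ∈ Set.Icc (0 : ℝ) 1, (1 - r) * α + r * β ≠ 0 := by
    intro r hr h0
    have hz : p + ((1 - r) * t + r * l) • (q - p) ∈ segment ℝ p q := by
      rw [segment_eq_image']
      refine ⟨_, ⟨?_, ?_⟩, rfl⟩
      · nlinarith [mul_nonneg (sub_nonneg.2 hr.2) ht0, mul_nonneg hr.1 hl.1]
      · nlinarith [mul_nonneg (sub_nonneg.2 hr.2) (sub_nonneg.2 htl), hl.2]
    have hz' : (1 - r) • p' + r • m' ∈ segment ℝ p' q' :=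
      (convex_segment p' q') (left_mem_segment ℝ p' q') hm' (by linarith [hr.2]) hr.1 (by ring)
    refine Set.disjoint_left.1 hdisj hz ?_
    convert hz' using 1
    -- the two points have the same coordinates `along` and `height`
    have h1 : along e (p + ((1 - r) * t + r * l) • (q - p)) = along e ((1 - r) • p' + r • m') := by
      have g1 : along e (p + ((1 - r) * t + r * l) • (q - p)) =
          along e p + ((1 - r) * t + r * l) * (along e q - along e p) := by simp [along]; ring
      have g2 : along e ((1 - r) • p' + r • m') = (1 - r) * along e p' + r * along e m' := by
        simp [along]; ring
      rw [g1, g2, hmc']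
      linear_combination (1 - r) * htX + r * hlX
    have h2 : height e (p + ((1 - r) * t + r * l) • (q - p)) =
        height e ((1 - r) • p' + r • m') := by
      rw [hα, hβ] at h0
      simp only [height, Prod.fst_add, Prod.snd_add, Prod.smul_fst, Prod.smul_snd, Prod.fst_sub,
        Prod.snd_sub, smul_eq_mul] at h0 ⊢
      linear_combination -h0
    have he : e.1 * e.1 + e.2 * e.2 ≠ 0 := by
      intro h
      have e1 : e.1 = 0 := by nlinarith [mul_self_nonneg e.1, mul_self_nonneg e.2]
      have e2 : e.2 = 0 := by nlinarith [mul_self_nonneg e.1, mul_self_nonneg e.2]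
      simp [along, e1, e2] at hpq
    generalize p + ((1 - r) * t + r * l) • (q - p) = a at h1 h2
    generalize (1 - r) • p' + r • m' = b at h1 h2
    simp only [along, height] at h1 h2
    ext
    · apply mul_left_cancel₀ he
      linear_combination e.1 * h1 - e.2 * h2
    · apply mul_left_cancel₀ he
      linear_combination e.2 * h1 + e.1 * h2
  have hαβ : 0 < α * β := by
    by_contra! hc
    have hd : α - β ≠ 0 := by
      intro h
      have : α = 0 := by nlinarith [mul_self_nonneg α, sub_eq_zero.1 h]
      exact hne 0 (by simp) (by simp [this])
    refine hne (α / (α - β)) ?_ (by field_simp; ring)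
    rcases lt_or_gt_of_ne hd with h | h
    · have h1 : α ≤ 0 := by
        by_contra! h'
        nlinarith
      have h2 : 0 ≤ β := by
        by_contra! h'
        nlinarith
      exact ⟨div_nonneg_of_nonpos h1 h.le, by rw [div_le_one_of_neg h]; linarith⟩
    · have h1 : 0 ≤ α := by
        by_contra! h'
        nlinarith
      have h2 : β ≤ 0 := by
        by_contra! h'
        nlinarith
      exact ⟨div_nonneg h1 h.le, by rw [div_le_one h]; linarith⟩
  have hdet : (e.1 * e.1 + e.2 * e.2) * planeDet (q - p) (p' - p) =
      (along e q - along e p) * α := by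
    have : planeDet (q - p) (p' - p) = planeDet (q - p) (p' - (p + t • (q - p))) := by
      simp [planeDet]; ring
    rw [this, hα]
    simp only [planeDet, along, height, Prod.fst_add, Prod.snd_add, Prod.smul_fst, Prod.smul_snd,
      Prod.fst_sub, Prod.snd_sub, smul_eq_mul] at htX ⊢
    clear_value t
    linear_combination (e.1 * (q.2 - p.2) - e.2 * (q.1 - p.1)) * htX
  have he : 0 ≤ e.1 * e.1 + e.2 * e.2 := add_nonneg (mul_self_nonneg _) (mul_self_nonneg _)
  have : 0 < (e.1 * e.1 + e.2 * e.2) * (planeDet (q - p) (p' - p) * β) := by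
    rw [← mul_assoc, hdet, mul_assoc]
    exact mul_pos hX hαβ
  exact pos_of_mul_pos_right this he

/-- The orientation of the points `p i` is determined by the order in which the segments
`[p i, q i]` meet the line; version with the points sorted by their distance to the line. The
functionals `f i` say that `p i` is cut off from the other points by a line that `[p i, q i]`
leaves on the other side. -/
theorem orientation_of_sorted {p q m : Fin 3 → ℝ × ℝ} {e : ℝ × ℝ} {c : ℝ}
    {f : Fin 3 → ℝ × ℝ →ₗ[ℝ] ℝ}
    (hpq : ∀ i, along e (p i) < along e (q i)) (hm : ∀ i, m i ∈ segment ℝ (p i) (q i))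
    (hmc : ∀ i, along e (m i) = c) (hp : ∀ i, along e (p i) ≤ c)
    (hdisj : ∀ i k, i ≠ k → Disjoint (segment ℝ (p i) (q i)) (segment ℝ (p k) (q k)))
    (hf : ∀ i k, i ≠ k → f i (p k - p i) < 0) (hfq : ∀ i, 0 < f i (q i - p i))
    {l n r : Fin 3} (hln : l ≠ n) (hlr : l ≠ r) (hnr : n ≠ r)
    (h1 : along e (p l) ≤ along e (p n)) (h2 : along e (p n) ≤ along e (p r)) :
    0 < planeDet (p n - p l) (p r - p l) * ((height e (m n) - height e (m l)) *
      (height e (m r) - height e (m n)) * (height e (m r) - height e (m l))) := by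
  have s1 := det_mul_height_pos (hpq l) (hm l) (hm n) (hmc l) (hmc n) h1 (hp n) (hdisj l n hln)
  have s2 := det_mul_height_pos (hpq n) (hm n) (hm r) (hmc n) (hmc r) h2 (hp r) (hdisj n r hnr)
  have s3 := det_mul_height_pos (hpq l) (hm l) (hm r) (hmc l) (hmc r) (h1.trans h2) (hp r)
    (hdisj l r hlr)
  have hD : planeDet (p n - p l) (p r - p l) ≠ 0 :=
    det_ne_zero_of_separated (hf l n hln) (hf l r hlr) (hf n l hln.symm) (hf n r hnr)
      (hf r l hlr.symm) (hf r n hnr.symm)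
  have i1 := apply_mul_planeDet (f l) (p n - p l) (p r - p l) (q l - p l)
  have i2 := apply_mul_planeDet (f n) (p r - p n) (p l - p n) (q n - p n)
  have i3 : (along e (p r) - along e (p n)) * planeDet (q n - p n) (p l - p n) =
      (along e (q n) - along e (p n)) * planeDet (p r - p n) (p l - p n) +
        (along e (p l) - along e (p n)) * planeDet (q n - p n) (p r - p n) := by
    simp [planeDet, along]; ring
  have hDn : planeDet (p r - p n) (p l - p n) = planeDet (p n - p l) (p r - p l) := by
    simp [planeDet]; ring
  rw [hDn] at i2 i3
  have f1 := hf l n hln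
  have f2 := hf l r hlr
  have f3 := hf n l hln.symm
  have f4 := hf n r hnr
  have fl := hfq l
  have fn := hfq n
  have hw := hpq n
  generalize planeDet (p n - p l) (p r - p l) = D at *
  generalize planeDet (q l - p l) (p n - p l) = Sn at *
  generalize planeDet (q l - p l) (p r - p l) = Sr at *
  generalize planeDet (q n - p n) (p r - p n) = T at *
  generalize planeDet (q n - p n) (p l - p n) = U at *
  generalize height e (m l) = yl at *
  generalize height e (m n) = yn at *
  generalize height e (m r) = yr at *
  generalize f l (p n - p l) = a at *
  generalize f l (p r - p l) = b at *
  generalize f n (p l - p n) = a' at *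
  generalize f n (p r - p n) = b' at *
  generalize f l (q l - p l) = w at *
  generalize f n (q n - p n) = w' at *
  have hx1 : 0 ≤ along e (p r) - along e (p n) := by linarith
  have hx2 : along e (p l) - along e (p n) ≤ 0 := by linarith
  have hx3 : 0 < along e (q n) - along e (p n) := by linarith
  generalize along e (p r) - along e (p n) = x1 at *
  generalize along e (p l) - along e (p n) = x2 at *
  generalize along e (q n) - along e (p n) = x3 at *
  -- if `D` and `T` had opposite signs, `q n - p n` would point into the triangle at `p n`
  have hDT : 0 < D * T := by
    have hT : T ≠ 0 := by rintro rfl; simp at s2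
    rcases lt_or_gt_of_ne hD with hD' | hD' <;> rcases lt_or_gt_of_ne hT with hT' | hT'
    · exact mul_pos_of_neg_of_neg hD' hT'
    · exfalso
      have hU : U < 0 := by
        by_contra! hU
        nlinarith [mul_nonneg hx1 hU, mul_pos hx3 (neg_pos.2 hD'),
          mul_nonneg (neg_nonneg.2 hx2) hT'.le]
      nlinarith [mul_pos fn (neg_pos.2 hD'), mul_pos (neg_pos.2 f4) (neg_pos.2 hU),
        mul_pos (neg_pos.2 f3) hT']
    · exfalso
      have hU : 0 < U := by
        by_contra! hU
        nlinarith [mul_nonneg hx1 (neg_nonneg.2 hU), mul_pos hx3 hD',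
          mul_nonneg (neg_nonneg.2 hx2) (neg_nonneg.2 hT'.le)]
      nlinarith [mul_pos fn hD', mul_pos (neg_pos.2 f4) hU,
        mul_pos (neg_pos.2 f3) (neg_pos.2 hT')]
    · exact mul_pos hD' hT'
  have hDy : 0 < D * (yr - yn) := by
    have : 0 < (D * (yr - yn)) * (T * T) := by nlinarith [mul_pos hDT s2]
    exact pos_of_mul_pos_left this (mul_self_nonneg T)
  -- otherwise `yn < yl < yr` or `yr < yl < yn`, and `q l - p l` would point into the triangle
  have hy : 0 < (yn - yl) * (yr - yl) := by
    have hn : yn - yl ≠ 0 := by intro h; simp [h] at s1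
    have hr : yr - yl ≠ 0 := by intro h; simp [h] at s3
    rcases lt_or_gt_of_ne hn with hn' | hn' <;> rcases lt_or_gt_of_ne hr with hr' | hr'
    · exact mul_pos_of_neg_of_neg hn' hr'
    · exfalso
      have hSn : Sn < 0 := by nlinarith
      have hSr : 0 < Sr := by nlinarith
      have hD' : 0 < D := by nlinarith
      nlinarith [mul_pos fl hD', mul_pos (neg_pos.2 f1) hSr,
        mul_pos (neg_pos.2 f2) (neg_pos.2 hSn)]
    · exfalso
      have hSn : 0 < Sn := by nlinarith
      have hSr : Sr < 0 := by nlinarith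
      have hD' : D < 0 := by nlinarith
      nlinarith [mul_pos fl (neg_pos.2 hD'), mul_pos (neg_pos.2 f1) (neg_pos.2 hSr),
        mul_pos (neg_pos.2 f2) hSn]
    · exact mul_pos hn' hr'
  calc 0 < (D * (yr - yn)) * ((yn - yl) * (yr - yl)) := mul_pos hDy hy
    _ = _ := by ring

/-- The order in which the segments `[p i, q i]` meet the line `along e = c`, given by the sign of
a Vandermonde product of heights, is the orientation of the points `p i`. -/
theorem orientation_mul_pos {p q m : Fin 3 → ℝ × ℝ} {e : ℝ × ℝ} {c : ℝ}
    {f : Fin 3 → ℝ × ℝ →ₗ[ℝ] ℝ}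
    (hpq : ∀ i, along e (p i) < along e (q i)) (hm : ∀ i, m i ∈ segment ℝ (p i) (q i))
    (hmc : ∀ i, along e (m i) = c) (hp : ∀ i, along e (p i) ≤ c)
    (hdisj : ∀ i k, i ≠ k → Disjoint (segment ℝ (p i) (q i)) (segment ℝ (p k) (q k)))
    (hf : ∀ i k, i ≠ k → f i (p k - p i) < 0) (hfq : ∀ i, 0 < f i (q i - p i)) :
    0 < planeDet (p 1 - p 0) (p 2 - p 0) * ((height e (m 1) - height e (m 0)) *
      (height e (m 2) - height e (m 1)) * (height e (m 2) - height e (m 0))) := by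
  -- both factors change sign under a transposition of the indices
  have key {l n r : Fin 3} (hln : l ≠ n) (hlr : l ≠ r) (hnr : n ≠ r) :=
    orientation_of_sorted hpq hm hmc hp hdisj hf hfq hln hlr hnr
  rcases le_total (along e (p 0)) (along e (p 1)) with h01 | h01 <;>
    rcases le_total (along e (p 1)) (along e (p 2)) with h12 | h12 <;>
    rcases le_total (along e (p 0)) (along e (p 2)) with h02 | h02
  · exact key (by decide) (by decide) (by decide) h01 h12
  · exact key (by decide) (by decide) (by decide) h01 h12
  · convert key (l := 0) (n := 2) (r := 1) (by decide) (by decide) (by decide) h02 h12 using 1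
    simp only [planeDet, Prod.fst_sub, Prod.snd_sub]; ring
  · convert key (l := 2) (n := 0) (r := 1) (by decide) (by decide) (by decide) h02 h01 using 1
    simp only [planeDet, Prod.fst_sub, Prod.snd_sub]; ring
  · convert key (l := 1) (n := 0) (r := 2) (by decide) (by decide) (by decide) h01 h02 using 1
    simp only [planeDet, Prod.fst_sub, Prod.snd_sub]; ring
  · convert key (l := 1) (n := 2) (r := 0) (by decide) (by decide) (by decide) h12 h02 using 1
    simp only [planeDet, Prod.fst_sub, Prod.snd_sub]; ring
  · convert key (l := 2) (n := 1) (r := 0) (by decide) (by decide) (by decide) h12 h01 using 1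
    simp only [planeDet, Prod.fst_sub, Prod.snd_sub]; ring
  · convert key (l := 2) (n := 1) (r := 0) (by decide) (by decide) (by decide) h12 h01 using 1
    simp only [planeDet, Prod.fst_sub, Prod.snd_sub]; ring

/-- Two triangles on the two sides of a line, joined by three disjoint segments that leave both of
them, have opposite orientations: the plane drawing of `K_{2,3}` has opposite rotations at its two
vertices of degree three. -/
theorem det_mul_det_neg {p q : Fin 3 → ℝ × ℝ} {e : ℝ × ℝ →ₗ[ℝ] ℝ} {c : ℝ}
    {f g : Fin 3 → ℝ × ℝ →ₗ[ℝ] ℝ}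
    (hpq : ∀ i, e (p i) < e (q i)) (hp : ∀ i, e (p i) ≤ c) (hq : ∀ i, c ≤ e (q i))
    (hdisj : ∀ i k, i ≠ k → Disjoint (segment ℝ (p i) (q i)) (segment ℝ (p k) (q k)))
    (hf : ∀ i k, i ≠ k → f i (p k - p i) < 0) (hfq : ∀ i, 0 < f i (q i - p i))
    (hg : ∀ i k, i ≠ k → g i (q k - q i) < 0) (hgp : ∀ i, 0 < g i (p i - q i)) :
    planeDet (p 1 - p 0) (p 2 - p 0) * planeDet (q 1 - q 0) (q 2 - q 0) < 0 := by
  obtain ⟨d, hd⟩ : ∃ d : ℝ × ℝ, ∀ v, e v = along d v :=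
    ⟨(e (1, 0), e (0, 1)), fun v => by rw [linearMap_apply_prod]; simp only [along]; ring⟩
  simp only [hd] at hpq hp hq
  have hex (i : Fin 3) : ∃ m ∈ segment ℝ (p i) (q i), along d m = c := by
    have hX : 0 < along d (q i) - along d (p i) := by linarith [hpq i]
    refine ⟨p i + ((c - along d (p i)) / (along d (q i) - along d (p i))) • (q i - p i), ?_, ?_⟩
    · rw [segment_eq_image']
      exact ⟨_, ⟨div_nonneg (by linarith [hp i]) hX.le,
        by rw [div_le_one hX]; linarith [hq i]⟩, rfl⟩
    · have (t : ℝ) : along d (p i + t • (q i - p i)) =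
          along d (p i) + t * (along d (q i) - along d (p i)) := by simp [along]; ring
      rw [this, div_mul_cancel₀ _ hX.ne']
      ring
  choose m hm hmc using hex
  have h1 := orientation_mul_pos hpq hm hmc hp hdisj hf hfq
  have h2 := orientation_mul_pos (e := -d) (c := -c) (p := q) (q := p) (m := m) (f := g)
    (fun i => by simpa [along_neg] using hpq i) (fun i => by rw [segment_symm]; exact hm i)
    (fun i => by simp [along_neg, hmc i]) (fun i => by simpa [along_neg] using hq i)
    (fun i k hik => by rw [segment_symm, segment_symm ℝ (q k)]; exact hdisj i k hik) hg hgp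
  simp only [height_neg] at h2
  generalize planeDet (p 1 - p 0) (p 2 - p 0) = D at *
  generalize planeDet (q 1 - q 0) (q 2 - q 0) = D' at *
  obtain ⟨V, hV⟩ : ∃ V, V = (height d (m 1) - height d (m 0)) *
      (height d (m 2) - height d (m 1)) * (height d (m 2) - height d (m 0)) := ⟨_, rfl⟩
  rw [← hV] at h1
  have h3 : 0 < D' * -V := by convert h2 using 1; rw [hV]; ring
  by_contra! hc
  nlinarith [mul_pos h1 h3, mul_nonneg hc (mul_self_nonneg V)]

end PlaneOrientation

/-! ### Coplanar polygons -/

section PlanarCase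

theorem exists_injective_choice {ι α : Type*} [Fintype ι] {S : ι → Set α}
    (hS : ∀ i, (S i).Infinite) : ∃ f : ι → α, Function.Injective f ∧ ∀ i, f i ∈ S i := by
  classical
  choose t ht htc using fun i => (hS i).exists_subset_card_eq (Fintype.card ι)
  obtain ⟨f, hf, hft⟩ := (Finset.all_card_le_biUnion_card_iff_exists_injective t).1 (by
    intro s
    rcases s.eq_empty_or_nonempty with rfl | ⟨i, hi⟩
    · simp
    · calc s.card ≤ Fintype.card ι := Finset.card_le_univ s
        _ = (t i).card := (htc i).symm
        _ ≤ _ := Finset.card_le_card (Finset.subset_biUnion_of_mem t hi))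
  exact ⟨f, hf, fun i => ht i (hft i)⟩

variable {E : Type*} [NormedAddCommGroup E] [NormedSpace ℝ E]

/-- A supporting functional that is not zero on the whole polygon vanishes at inner points of at
most one side. -/
theorem IsPolygonSide.ne_zero_of_isInnerPoint {P s t : Set E} {x y : E} (hP : IsConvexPolygon P)
    (hs : IsPolygonSide P s) (ht : IsPolygonSide P t) (hst : s ≠ t) (hx : IsInnerPoint s x)
    (hy : IsInnerPoint t y) {f : E →ᵃ[ℝ] ℝ}
    (hf : (∀ p ∈ P, 0 ≤ f p) ∨ ∀ p ∈ P, f p ≤ 0) (hf0 : ¬ ∀ p ∈ P, f p = 0) (hfx : f x = 0) :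
    f y ≠ 0 := fun hfy =>
  hf0 (hs.eq_zero_of_ne hP ht hst (hs.eq_zero_of_isInnerPoint hx hf hfx)
    (ht.eq_zero_of_isInnerPoint hy hf hfy))

/-- Affine coordinates on a plane in 3-space: a parametrization `ψ` and a retraction `π`. -/
theorem exists_planeCoordinates (hE : Module.finrank ℝ E = 3) {h : E →ᵃ[ℝ] ℝ} (h0 : h ≠ 0)
    {a : E} (ha : h a = 0) : ∃ (ψ : ℝ × ℝ →ᵃ[ℝ] E) (π : E →ᵃ[ℝ] ℝ × ℝ),
      (∀ z, π (ψ z) = z) ∧ ∀ x, h x = 0 → ψ (π x) = x := by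
  have hfin : FiniteDimensional ℝ E := Module.finite_of_finrank_pos (by omega)
  have hlin (x : E) : h.linear (x - a) = h x := by simpa [ha] using h.linearMap_vsub x a
  have hl0 : h.linear ≠ 0 := fun h' => h0 <| AffineMap.ext fun x => by
    rw [← hlin x, h']; simp
  have hK : Module.finrank ℝ (LinearMap.ker h.linear) = Module.finrank ℝ (ℝ × ℝ) := by
    have h1 := LinearMap.finrank_range_add_finrank_ker h.linear
    rw [LinearMap.range_eq_top.2 (LinearMap.surjective hl0), finrank_top, Module.finrank_self,
      hE] at h1
    rw [Module.finrank_prod, Module.finrank_self]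
    omega
  let e := LinearEquiv.ofFinrankEq _ _ hK
  obtain ⟨ρ, hρ⟩ := (LinearMap.ker h.linear).subtype.exists_leftInverse_of_injective
    (Submodule.ker_subtype _)
  have hρ' (v : LinearMap.ker h.linear) : ρ v = v := LinearMap.congr_fun hρ v
  refine ⟨((LinearMap.ker h.linear).subtype ∘ₗ e.symm.toLinearMap).toAffineMap +
      AffineMap.const ℝ _ a,
    (e.toLinearMap ∘ₗ ρ).toAffineMap - AffineMap.const ℝ _ (e (ρ a)), fun z => ?_,
    fun x hx => ?_⟩
  · simp [hρ']
  · have hv : x - a ∈ LinearMap.ker h.linear := by rw [LinearMap.mem_ker, hlin, hx]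
    have := hρ' ⟨x - a, hv⟩
    simp only [map_sub] at this
    simp [← map_sub, this]

variable {ψ : ℝ × ℝ →ᵃ[ℝ] E} {π : E →ᵃ[ℝ] ℝ × ℝ}

theorem IsConvexPolygon.interior_preimage_nonempty {P : Set E} (hP : IsConvexPolygon P)
    (hPψ : ∀ x ∈ P, ψ (π x) = x) : (interior (ψ ⁻¹' P)).Nonempty := by
  have himg : ψ '' (ψ ⁻¹' P) = P := by
    rw [Set.image_preimage_eq_iff]
    exact fun x hx => ⟨π x, hPψ x hx⟩
  have hle : 2 ≤ Module.finrank ℝ (vectorSpan ℝ (ψ ⁻¹' P)) := by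
    have h1 := ψ.map_vectorSpan (s := ψ ⁻¹' P)
    rw [himg] at h1
    rw [← hP.2, ← h1]
    exact Submodule.finrank_map_le _ _
  have hne : (ψ ⁻¹' P).Nonempty := by
    rw [Set.nonempty_iff_ne_empty]
    intro h
    rw [h, vectorSpan_empty, finrank_bot] at hle
    omega
  rw [(hP.convex.affine_preimage ψ).interior_nonempty_iff_affineSpan_eq_top,
    AffineSubspace.affineSpan_eq_top_iff_vectorSpan_eq_top_of_nonempty _ _ _ hne]
  refine Submodule.eq_top_of_finrank_eq (le_antisymm (Submodule.finrank_le _) ?_)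
  simpa using hle

theorem apply_mem_intrinsicInterior [FiniteDimensional ℝ E] (hπψ : ∀ z, π (ψ z) = z) {P : Set E}
    (hPψ : ∀ x ∈ P, ψ (π x) = x) {z : ℝ × ℝ} (hz : z ∈ interior (ψ ⁻¹' P)) :
    ψ z ∈ intrinsicInterior ℝ P := by
  have hspan (x : E) (hx : x ∈ affineSpan ℝ P) : ψ (π x) = x := by
    have hle : affineSpan ℝ P ≤ (⊤ : AffineSubspace ℝ (ℝ × ℝ)).map ψ :=
      affineSpan_le.2 fun x hx => ⟨π x, trivial, hPψ x hx⟩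
    obtain ⟨z, -, rfl⟩ := hle hx
    rw [hπψ]
  have hmem : ψ z ∈ P := interior_subset (s := ψ ⁻¹' P) hz
  refine mem_intrinsicInterior.2 ⟨⟨ψ z, subset_affineSpan ℝ P hmem⟩, ?_, rfl⟩
  refine mem_interior.2 ⟨{x : affineSpan ℝ P | π x ∈ interior (ψ ⁻¹' P)}, ?_, ?_, ?_⟩
  · intro x hx
    have := interior_subset (s := ψ ⁻¹' P) hx
    rwa [Set.mem_preimage, hspan x x.2] at this
  · exact isOpen_interior.preimage
      ((AffineMap.continuous_of_finiteDimensional π).comp continuous_subtype_val)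
  · rw [Set.mem_ofPred_eq]
    rwa [hπψ]

/-- Two polygons in a common plane with disjoint relative interiors are separated by a line of that
plane. -/
theorem IsConvexPolygon.exists_separating [FiniteDimensional ℝ E] (hπψ : ∀ z, π (ψ z) = z)
    {P Q : Set E} (hP : IsConvexPolygon P) (hQ : IsConvexPolygon Q)
    (hPψ : ∀ x ∈ P, ψ (π x) = x) (hQψ : ∀ x ∈ Q, ψ (π x) = x)
    (hd : Disjoint (intrinsicInterior ℝ P) (intrinsicInterior ℝ Q)) :
    ∃ (d : ℝ × ℝ →ₗ[ℝ] ℝ) (c : ℝ), (∀ x ∈ P, d (π x) ≤ c) ∧ (∀ x ∈ Q, c ≤ d (π x)) ∧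
      (¬ ∀ x ∈ P, d (π x) = c) ∧ ¬ ∀ x ∈ Q, d (π x) = c := by
  have hcP : Convex ℝ (ψ ⁻¹' P) := hP.convex.affine_preimage ψ
  have hcQ : Convex ℝ (ψ ⁻¹' Q) := hQ.convex.affine_preimage ψ
  have hiP := hP.interior_preimage_nonempty hPψ
  have hiQ := hQ.interior_preimage_nonempty hQψ
  obtain ⟨d, c, hdP, hdQ⟩ := geometric_hahn_banach_open_open hcP.interior isOpen_interior
    hcQ.interior isOpen_interior (Set.disjoint_left.2 fun z hz hz' =>
      Set.disjoint_left.1 hd (apply_mem_intrinsicInterior hπψ hPψ hz)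
        (apply_mem_intrinsicInterior hπψ hQψ hz'))
  refine ⟨d, c, fun x hx => ?_, fun x hx => ?_, fun h => ?_, fun h => ?_⟩
  · have hx' : π x ∈ closure (interior (ψ ⁻¹' P)) := by
      rw [hcP.closure_interior_eq_closure_of_nonempty_interior hiP]
      exact subset_closure (by rwa [Set.mem_preimage, hPψ x hx])
    exact closure_minimal (fun z hz => (hdP z hz).le) (isClosed_le d.continuous continuous_const)
      hx'
  · have hx' : π x ∈ closure (interior (ψ ⁻¹' Q)) := by
      rw [hcQ.closure_interior_eq_closure_of_nonempty_interior hiQ]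
      exact subset_closure (by rwa [Set.mem_preimage, hQψ x hx])
    exact closure_minimal (fun z hz => (hdQ z hz).le) (isClosed_le continuous_const d.continuous)
      hx'
  · obtain ⟨z, hz⟩ := hiP
    have h1 := h _ (interior_subset (s := ψ ⁻¹' P) hz)
    rw [hπψ] at h1
    exact (hdP z hz).ne h1
  · obtain ⟨z, hz⟩ := hiQ
    have h1 := h _ (interior_subset (s := ψ ⁻¹' Q) hz)
    rw [hπψ] at h1
    exact (hdQ z hz).ne' h1

/-- Coplanar polygons with disjoint relative interiors do not represent `K_{3,3}`. -/
theorem IsSideGrid.false_of_coplanar (hE : Module.finrank ℝ E = 3) {A B : Fin 3 → Set E}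
    {s : Fin 3 → Fin 3 → Set E} (G : IsSideGrid A B s) {h : E →ᵃ[ℝ] ℝ} (h0 : h ≠ 0)
    (hA : ∀ i, ∀ p ∈ A i, h p = 0) (hB : ∀ j, ∀ p ∈ B j, h p = 0)
    (hAA : ∀ i k, i ≠ k → Disjoint (intrinsicInterior ℝ (A i)) (intrinsicInterior ℝ (A k)))
    (hBB : ∀ i k, i ≠ k → Disjoint (intrinsicInterior ℝ (B i)) (intrinsicInterior ℝ (B k)))
    (hAB : ∀ i j, Disjoint (intrinsicInterior ℝ (A i)) (intrinsicInterior ℝ (B j))) : False := by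
  have hfin : FiniteDimensional ℝ E := Module.finite_of_finrank_pos (by omega)
  -- inner points of the common sides, all distinct
  obtain ⟨x', hinj', hx'⟩ := exists_injective_choice
    (S := fun ij : Fin 3 × Fin 3 => {x | IsInnerPoint (s ij.1 ij.2) x})
    fun ij => (G.side_left ij.1 ij.2).infinite_isInnerPoint
  obtain ⟨x, hx, hinj⟩ : ∃ x : Fin 3 → Fin 3 → E, (∀ i j, IsInnerPoint (s i j) (x i j)) ∧
      ∀ i j i' j', x i j = x i' j' → j = j' :=
    ⟨fun i j => x' (i, j), fun i j => hx' (i, j), fun i j i' j' h => congrArg Prod.snd (hinj' h)⟩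
  clear hinj' hx' x'
  have hxA (i j) : x i j ∈ A i :=
    (G.side_left i j).subset ((hx i j).mem (G.left i) (G.side_left i j))
  have hxB (i j) : x i j ∈ B j :=
    (G.side_right i j).subset ((hx i j).mem (G.right j) (G.side_right i j))
  obtain ⟨ψ, π, hπψ, hψπ⟩ := exists_planeCoordinates hE h0 (hA 0 _ (hxA 0 0))
  have hAψ (i) (p : E) (hp : p ∈ A i) : ψ (π p) = p := hψπ p (hA i p hp)
  have hBψ (j) (p : E) (hp : p ∈ B j) : ψ (π p) = p := hψπ p (hB j p hp)
  let X : Fin 3 → Fin 3 → ℝ × ℝ := fun i j => π (x i j)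
  have hXinj (i j i' j') (e : X i j = X i' j') : j = j' := by
    apply hinj i j i' j'
    rw [← hAψ i _ (hxA i j), ← hAψ i' _ (hxA i' j')]
    exact congrArg ψ e
  -- functionals on the plane as affine functionals on the space
  let F : (ℝ × ℝ →ₗ[ℝ] ℝ) → ℝ → E →ᵃ[ℝ] ℝ := fun d c =>
    d.toAffineMap.comp π - AffineMap.const ℝ E c
  have hF (d c) (p : E) : F d c p = d (π p) - c := by simp [F]
  have hsneA (i) {j j'} (hj : j ≠ j') : s i j ≠ s i j' := fun e => hj (G.inj_right _ _ _ _ e)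
  have hsneB (j) {i i'} (hi : i ≠ i') : s i j ≠ s i' j := fun e => hi (G.inj_left _ _ _ _ e)
  -- the lines along the common sides
  have hside (i j) : ∃ d : ℝ × ℝ →ₗ[ℝ] ℝ, (∀ k, j ≠ k → d (X i k - X i j) < 0) ∧
      ∀ i', i' ≠ i → 0 < d (X i' j - X i j) := by
    obtain ⟨d, c, hdA, hdB, hnA, hnB⟩ := (G.left i).exists_separating hπψ (G.right j) (hAψ i)
      (hBψ j) (hAB i j)
    have hFA : ∀ p ∈ A i, F d c p ≤ 0 := fun p hp => by rw [hF]; linarith [hdA p hp]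
    have hFB : ∀ p ∈ B j, 0 ≤ F d c p := fun p hp => by rw [hF]; linarith [hdB p hp]
    have hz : F d c (x i j) = 0 := le_antisymm (hFA _ (hxA i j)) (hFB _ (hxB i j))
    refine ⟨d, fun k hk => ?_, fun i' hi' => ?_⟩
    · have h1 := (G.side_left i j).ne_zero_of_isInnerPoint (G.left i) (G.side_left i k)
        (hsneA i hk) (hx i j) (hx i k) (f := F d c) (Or.inr hFA)
        (fun h => hnA fun p hp => by have := h p hp; rw [hF] at this; linarith) hz
      have h2 := lt_of_le_of_ne (hFA _ (hxA i k)) h1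
      rw [hF] at h2 hz
      rw [map_sub]
      simp only [X]
      linarith
    · have h1 := (G.side_right i j).ne_zero_of_isInnerPoint (G.right j) (G.side_right i' j)
        (hsneB j hi'.symm) (hx i j) (hx i' j) (f := F d c) (Or.inl hFB)
        (fun h => hnB fun p hp => by have := h p hp; rw [hF] at this; linarith) hz
      have h2 := lt_of_le_of_ne (hFB _ (hxB i' j)) h1.symm
      rw [hF] at h2 hz
      rw [map_sub]
      simp only [X]
      linarith
  choose D hDA hDB using hside
  -- the segments through different `B j` are disjoint
  have hdisj (i i') (hi : i ≠ i') (j k) (hjk : j ≠ k) :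
      Disjoint (segment ℝ (X i j) (X i' j)) (segment ℝ (X i k) (X i' k)) := by
    obtain ⟨d, c, hdj, hdk, hnj, hnk⟩ := (G.right j).exists_separating hπψ (G.right k) (hBψ j)
      (hBψ k) (hBB j k hjk)
    have hFj : ∀ p ∈ B j, F d c p ≤ 0 := fun p hp => by rw [hF]; linarith [hdj p hp]
    have hFk : ∀ p ∈ B k, 0 ≤ F d c p := fun p hp => by rw [hF]; linarith [hdk p hp]
    have hj := fun hz => (G.side_right i j).ne_zero_of_isInnerPoint (G.right j)
      (G.side_right i' j) (hsneB j hi) (hx i j) (hx i' j) (f := F d c) (Or.inr hFj)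
      (fun h => hnj fun p hp => by have := h p hp; rw [hF] at this; linarith) hz
    have hk := fun hz => (G.side_right i k).ne_zero_of_isInnerPoint (G.right k)
      (G.side_right i' k) (hsneB k hi) (hx i k) (hx i' k) (f := F d c) (Or.inl hFk)
      (fun h => hnk fun p hp => by have := h p hp; rw [hF] at this; linarith) hz
    have j1 := hFj _ (hxB i j)
    have j2 := hFj _ (hxB i' j)
    have k1 := hFk _ (hxB i k)
    have k2 := hFk _ (hxB i' k)
    simp only [hF] at hj hk j1 j2 k1 k2
    refine Set.disjoint_left.2 ?_
    rintro z ⟨α, β, hα, hβ, hαβ, rfl⟩ ⟨α', β', hα', hβ', hαβ', hz⟩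
    -- a common point lies on the separating line, hence is an end point of both segments
    have e1 : d (α • X i j + β • X i' j) - c =
        α * (d (π (x i j)) - c) + β * (d (π (x i' j)) - c) := by
      rw [map_add, map_smul, map_smul, smul_eq_mul, smul_eq_mul]
      linear_combination c * hαβ
    have e2 : d (α' • X i k + β' • X i' k) - c =
        α' * (d (π (x i k)) - c) + β' * (d (π (x i' k)) - c) := by
      rw [map_add, map_smul, map_smul, smul_eq_mul, smul_eq_mul]
      linear_combination c * hαβ'
    rw [hz] at e2
    have z1 := mul_nonpos_of_nonneg_of_nonpos hα j1
    have z2 := mul_nonpos_of_nonneg_of_nonpos hβ j2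
    have z3 := mul_nonneg hα' k1
    have z4 := mul_nonneg hβ' k2
    have w1 : α = 0 ∨ β = 0 := by
      by_contra! hc
      exact hj ((mul_eq_zero.1 (by linarith :
        α * (d (π (x i j)) - c) = 0)).resolve_left hc.1) ((mul_eq_zero.1 (by linarith :
        β * (d (π (x i' j)) - c) = 0)).resolve_left hc.2)
    have w2 : α' = 0 ∨ β' = 0 := by
      by_contra! hc
      exact hk ((mul_eq_zero.1 (by linarith :
        α' * (d (π (x i k)) - c) = 0)).resolve_left hc.1) ((mul_eq_zero.1 (by linarith :
        β' * (d (π (x i' k)) - c) = 0)).resolve_left hc.2)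
    have c1 (hβ : β = 0) : α = 1 := by linarith
    have c2 (hα : α = 0) : β = 1 := by linarith
    have c3 (hβ : β' = 0) : α' = 1 := by linarith
    have c4 (hα : α' = 0) : β' = 1 := by linarith
    rcases w1 with w1 | w1 <;> rcases w2 with w2 | w2
    · rw [w1, w2, c2 w1, c4 w2, zero_smul, zero_smul, one_smul, one_smul, zero_add, zero_add] at hz
      exact hjk (hXinj _ _ _ _ hz).symm
    · rw [w1, w2, c2 w1, c3 w2, zero_smul, zero_smul, one_smul, one_smul, zero_add, add_zero] at hz
      exact hjk (hXinj _ _ _ _ hz).symm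
    · rw [w1, w2, c1 w1, c4 w2, zero_smul, zero_smul, one_smul, one_smul, zero_add, add_zero] at hz
      exact hjk (hXinj _ _ _ _ hz).symm
    · rw [w1, w2, c1 w1, c3 w2, zero_smul, zero_smul, one_smul, one_smul, add_zero, add_zero] at hz
      exact hjk (hXinj _ _ _ _ hz).symm
  have hneg (i i') (hi : i ≠ i') :
      planeDet (X i 1 - X i 0) (X i 2 - X i 0) *
        planeDet (X i' 1 - X i' 0) (X i' 2 - X i' 0) < 0 := by
    obtain ⟨d, c, hd, hd', hn, -⟩ := (G.left i).exists_separating hπψ (G.left i') (hAψ i)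
      (hAψ i') (hAA i i' hi)
    refine det_mul_det_neg (p := X i) (q := X i') (e := d) (c := c) (f := D i) (g := D i')
      (fun j => ?_) (fun j => hd _ (hxA i j)) (fun j => hd' _ (hxA i' j)) (hdisj i i' hi)
      (hDA i) (fun j => hDB i j i' hi.symm) (hDA i') (fun j => hDB i' j i hi)
    -- otherwise two sides of `B j` lie on the line separating `A i` from `A i'`
    refine lt_of_le_of_ne ((hd _ (hxA i j)).trans (hd' _ (hxA i' j))) fun he => hn ?_
    have h1 : F d c (x i j) = 0 := by
      rw [hF]; exact sub_eq_zero.2 (le_antisymm (hd _ (hxA i j)) (he ▸ hd' _ (hxA i' j)))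
    have h2 : F d c (x i' j) = 0 := by
      rw [hF]; exact sub_eq_zero.2 (le_antisymm (he ▸ hd _ (hxA i j)) (hd' _ (hxA i' j)))
    have h3 : ∀ p ∈ B j, F d c p = 0 :=
      (G.side_right i j).eq_zero_of_ne (G.right j) (G.side_right i' j) (hsneB j hi)
        ((G.side_left i j).eq_zero_of_isInnerPoint (hx i j)
          (Or.inr fun p hp => by rw [hF]; linarith [hd p hp]) h1)
        ((G.side_left i' j).eq_zero_of_isInnerPoint (hx i' j)
          (Or.inl fun p hp => by rw [hF]; linarith [hd' p hp]) h2)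
    obtain ⟨g, -, -, hg⟩ := (G.right j).exists_planeEquation hE
    obtain ⟨r, hr⟩ := hg _ h3
    obtain ⟨r', hr'⟩ := hg _ (hB j)
    intro p hp
    have h4 : r' * g p = 0 := by
      have := hA i p hp
      rwa [hr'] at this
    have hr0 : r' ≠ 0 := by
      rintro rfl
      exact h0 (by rw [hr', zero_smul])
    have h5 : F d c p = 0 := by
      rw [hr]
      simp [(mul_eq_zero.1 h4).resolve_left hr0]
    rw [hF] at h5
    linarith
  -- three reals cannot have pairwise negative products
  have h01 := hneg 0 1 (by decide)
  have h02 := hneg 0 2 (by decide)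
  have h12 := hneg 1 2 (by decide)
  nlinarith [mul_pos_of_neg_of_neg h01 h02, sq_nonneg (planeDet (X 0 1 - X 0 0) (X 0 2 - X 0 0))]

end PlanarCase

/-! ### The complete bipartite graph -/

theorem IsSideContactRepresentation.exists_isSideGrid {I J : Type*}
    {p : I ⊕ J → Set (EuclideanSpace ℝ (Fin 3))}
    (hp : IsSideContactRepresentation (completeBipartiteGraph I J) p) :
    ∃ s, IsSideGrid (fun i => p (Sum.inl i)) (fun j => p (Sum.inr j)) s := by
  have hex (i : I) (j : J) : ∃ s, IsPolygonSide (p (Sum.inl i)) s ∧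
      IsPolygonSide (p (Sum.inr j)) s :=
    (hp.adj_iff _ _ Sum.inl_ne_inr).1 (by simp)
  choose s hsA hsB using hex
  have hthree (t : Set (EuclideanSpace ℝ (Fin 3))) {u v w : I ⊕ J} (huv : u ≠ v) (huw : u ≠ w)
      (hvw : v ≠ w) (hu : IsPolygonSide (p u) t) (hv : IsPolygonSide (p v) t)
      (hw : IsPolygonSide (p w) t) : False := by
    have h1 : ({u, v, w} : Set (I ⊕ J)) ⊆ {x | IsPolygonSide (p x) t} := by
      rintro x (rfl | rfl | rfl)
      · exact hu
      · exact hv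
      · exact hw
    have h2 := (Set.encard_le_encard h1).trans (hp.side_le_two t)
    rw [Set.encard_eq_three.2 ⟨u, v, w, huv, huw, hvw, rfl⟩] at h2
    exact absurd h2 (by norm_num)
  refine ⟨s, fun i => hp.isConvexPolygon _, fun j => hp.isConvexPolygon _, hsA, hsB, ?_, ?_⟩
  · intro i j i' j' h
    by_contra hne
    exact hthree (s i j) (u := Sum.inl i) (v := Sum.inl i') (w := Sum.inr j) (by simpa using hne)
      Sum.inl_ne_inr Sum.inl_ne_inr (hsA i j) (h ▸ hsA i' j') (hsB i j)
  · intro i j i' j' h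
    by_contra hne
    exact hthree (s i j) (u := Sum.inr j) (v := Sum.inr j') (w := Sum.inl i) (by simpa using hne)
      Sum.inr_ne_inl Sum.inr_ne_inl (hsB i j) (h ▸ hsB i' j') (hsA i j)

theorem theorem2 :
    ¬ HasSideContactRepresentation (completeBipartiteGraph (Fin 3) (Fin 250)) := by
  rintro ⟨p, hp⟩
  have hE : Module.finrank ℝ (EuclideanSpace ℝ (Fin 3)) = 3 := by simp
  obtain ⟨s, G⟩ := hp.exists_isSideGrid
  obtain ⟨i, k, hik, h, h0, hi, hk⟩ := G.exists_coplanar hE (by simp)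
  have hB (j) : ∀ x ∈ p (Sum.inr j), h x = 0 :=
    (G.side_right i j).eq_zero_of_ne (G.right j) (G.side_right k j)
      (fun e => hik (G.inj_left _ _ _ _ e)) (fun x hx => hi x ((G.side_left i j).subset hx))
      (fun x hx => hk x ((G.side_left k j).subset hx))
  have hA (m) : ∀ x ∈ p (Sum.inl m), h x = 0 :=
    (G.side_left m 0).eq_zero_of_ne (G.left m) (G.side_left m 1)
      (fun e => absurd (G.inj_right _ _ _ _ e) (by decide))
      (fun x hx => hB 0 x ((G.side_right m 0).subset hx))
      (fun x hx => hB 1 x ((G.side_right m 1).subset hx))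
  let c : Fin 3 → Fin 250 := Fin.castLE (by norm_num)
  have hc : Function.Injective c := Fin.castLE_injective _
  have G' : IsSideGrid (fun i => p (Sum.inl i)) (fun j => p (Sum.inr (c j)))
      (fun i j => s i (c j)) :=
    ⟨G.left, fun j => G.right (c j), fun i j => G.side_left i (c j),
      fun i j => G.side_right i (c j), fun i j i' j' e => G.inj_left _ _ _ _ e,
      fun i j i' j' e => hc (G.inj_right _ _ _ _ e)⟩
  exact G'.false_of_coplanar hE h0 hA (fun j => hB (c j))
    (fun i k hik => hp.interior_disjoint _ _ (by simpa using hik))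
    (fun j k hjk => hp.interior_disjoint _ _ (by simpa [hc.eq_iff] using hjk))
    (fun i j => hp.interior_disjoint _ _ Sum.inl_ne_inr)
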